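/- Let $\{0,1\}^{\mathbb N}$ be Cantor space with pairing $\langle p,q\rangle(2k)=p(k)$, $\langle p,q\rangle(2k+1)=q(k)$. A represented space $(X,\delta_X)$ is a set $X$ with a partial surjection $\delta_X:\subseteq\{0,1\}^{\mathbb N}\to X$. A partial multivalued function $f:\subseteq X\rightrightarrows Y$ between represented spaces is realized by a partial function $F:\subseteq\{0,1\}^{\mathbb N}\to\{0,1\}^{\mathbb N}$ if $\delta_Y(F(p))\in f(\delta_X(p))$ for every $p\in\operatorname{dom}(f\circ\delta_X)$. Write $f\leq_{\mathrm W} g$ ($f$ is Weihrauch reducible to $g$) if there are partial functions $K,H$ on Cantor space, computable by Type-2 Turing machines, such that $p\mapsto K\langle p,G(H(p))\rangle$ realizes $f$ for every realizer $G$ of $g$; write $f<_{\mathrm W}g$ if $f\leq_{\mathrm W}g$ and not $g\leq_{\mathrm W}f$. Cantor space is represented by the identity, Baire space $\mathbb N^{\mathbb N}$ by $0^{n_0}10^{n_1}10^{n_2}1\ldots\mapsto(n_0,n_1,n_2,\ldots)$, and $X\times Y$ by $\langle p,q\rangle\mapsto(\delta_X(p),\delta_Y(q))$. Put $(f\times g)(x,y)=f(x)\times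 g(y)$, $f^0=\mathrm{id}_{\mathbb N^{\mathbb N}}$ and $f^{n+1}=f\times f^n$. Let $\mathsf{Sort}:\{0,1\}^{\mathbb N}\to\{0,1\}^{\mathbb N}$ be given by $\mathsf{Sort}(p)=0^m1^\omega$ if $p$ contains the bit $0$ exactly $m$ times, and $\mathsf{Sort}(p)=0^\omega$ if $p$ contains the bit $0$ infinitely often. Then for every $n\in\mathbb N=\{0,1,2,\ldots\}$ we have $\mathsf{Sort}^n<_{\mathrm W}\mathsf{Sort}^{n+1}$. -/

import Mathlib

namespace Weihrauch

/-- Cantor space; `false` is the bit `0` and `true` is the bit `1`. -/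
abbrev Cantor : Type := ℕ → Bool

/-- The finite prefix of `p` of length `n`. -/
def Cantor.take (p : Cantor) (n : ℕ) : List Bool := (List.range n).map p

/-- The interleaving `⟨p, q⟩`, with `p` at the even and `q` at the odd positions. -/
def pair (p q : Cantor) : Cantor := fun n => if n % 2 = 0 then p (n / 2) else q (n / 2)

def unpairL (r : Cantor) : Cantor := fun n => r (2 * n)

def unpairR (r : Cantor) : Cantor := fun n => r (2 * n + 1)

theorem unpairL_pair (p q : Cantor) : unpairL (pair p q) = p := by
  funext n
  simp [unpairL, pair]

theorem unpairR_pair (p q : Cantor) : unpairR (pair p q) = q := by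
  funext n
  have h1 : (2 * n + 1) % 2 = 1 := by omega
  have h2 : (2 * n + 1) / 2 = n := by omega
  simp [unpairR, pair, h1, h2]

/-- Type-2 computability of a partial function on Cantor space.  The word function `φ` describes
a machine with a write-once output tape: `φ w` is what has been written after `w.length` steps,
when at most the prefix `w` of the input has been read.  Outputs already written are never revised
(monotonicity), and on every input `p` in the domain of `F` the words written exhaust `F p`.
Nothing is demanded outside the domain of `F`. -/
def Type2Computable (F : Cantor →. Cantor) : Prop :=
  ∃ φ : List Bool → List Bool, Computable φ ∧
    (∀ u v : List Bool, u <+: v → φ u <+: φ v) ∧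
    ∀ p q : Cantor, q ∈ F p →
      (∀ n : ℕ, φ (p.take n) = q.take (φ (p.take n)).length) ∧
      ∀ m : ℕ, ∃ n : ℕ, m ≤ (φ (p.take n)).length

/-- A represented space: a set with a partial surjection from Cantor space onto it. -/
structure RepSpace where
  carrier : Type
  rep : Cantor →. carrier
  rep_surj : ∀ x : carrier, ∃ p : Cantor, x ∈ rep p

/-- Cantor space, represented by the identity. -/
def cantorSpace : RepSpace where
  carrier := Cantor
  rep := fun p => Part.some p
  rep_surj := fun p => ⟨p, Part.mem_some p⟩

/-- The sequence `n₀, n₁, n₂, …` such that `p = 0^{n₀} 1 0^{n₁} 1 0^{n₂} 1 …`, for a `p` that contains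
infinitely many bits `1`.  Here `Nat.nth (fun k => p k = true) i` is the position of the `i`-th `1`,
counted from zero. -/
noncomputable def blockLengths (p : Cantor) : ℕ → ℕ
  | 0 => Nat.nth (fun k => p k = true) 0
  | i + 1 => Nat.nth (fun k => p k = true) (i + 1) - (Nat.nth (fun k => p k = true) i + 1)

theorem exists_blockLengths_eq (x : ℕ → ℕ) :
    ∃ p : Cantor, {k | p k = true}.Infinite ∧ blockLengths p = x := by
  classical
  let s : ℕ → ℕ := fun i => (∑ j ∈ Finset.range (i + 1), x j) + i
  have s_succ : ∀ i, s (i + 1) = s i + 1 + x (i + 1) := by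
    intro i
    simp only [s, Finset.sum_range_succ _ (i + 1)]
    omega
  have hs : StrictMono s := strictMono_nat_of_lt_succ (fun i => by rw [s_succ]; omega)
  let p : Cantor := fun k => decide (∃ i, s i = k)
  have hp : ∀ k, p k = true ↔ ∃ i, s i = k := fun k => by simp [p]
  have hnth : ∀ i, Nat.nth (fun k => p k = true) i = s i := by
    intro i
    have hc : Nat.count (fun k => p k = true) (s i) = i := by
      rw [Nat.count_eq_card_filter_range]
      have : (Finset.range (s i)).filter (fun k => p k = true) = (Finset.range i).image s := by
        ext k
        simp only [Finset.mem_filter, Finset.mem_range, Finset.mem_image, hp]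
        constructor
        · rintro ⟨h1, j, rfl⟩
          exact ⟨j, hs.lt_iff_lt.1 h1, rfl⟩
        · rintro ⟨j, h1, rfl⟩
          exact ⟨hs h1, j, rfl⟩
      rw [this, Finset.card_image_of_injective _ hs.injective, Finset.card_range]
    have h := Nat.nth_count (p := fun k => p k = true) ((hp (s i)).2 ⟨i, rfl⟩)
    rwa [hc] at h
  refine ⟨p, ?_, ?_⟩
  · have : {k | p k = true} = Set.range s := by
      ext k
      exact hp k
    rw [this]
    exact Set.infinite_range_of_injective hs.injective
  · funext i
    cases i with
    | zero => simp [blockLengths, hnth, s]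
    | succ i =>
      simp only [blockLengths, hnth, s_succ]
      omega

/-- Baire space `ℕ → ℕ`, where `0^{n₀} 1 0^{n₁} 1 0^{n₂} 1 …` is the name of `n₀, n₁, n₂, …`. -/
noncomputable def baireSpace : RepSpace where
  carrier := ℕ → ℕ
  rep := fun p => ⟨{k | p k = true}.Infinite, fun _ => blockLengths p⟩
  rep_surj := by
    intro x
    obtain ⟨p, hp, rfl⟩ := exists_blockLengths_eq x
    exact ⟨p, hp, rfl⟩

/-- The product of represented spaces: `⟨p, q⟩` is a name of `(x, y)` if `p` is a name of `x` and
`q` is a name of `y`. -/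
def RepSpace.prod (X Y : RepSpace) : RepSpace where
  carrier := X.carrier × Y.carrier
  rep := fun r => (X.rep (unpairL r)).bind fun x => (Y.rep (unpairR r)).map fun y => (x, y)
  rep_surj := by
    rintro ⟨x, y⟩
    obtain ⟨p, hp⟩ := X.rep_surj x
    obtain ⟨q, hq⟩ := Y.rep_surj y
    refine ⟨pair p q, ?_⟩
    rw [unpairL_pair, unpairR_pair]
    exact Part.mem_bind hp (Part.mem_map _ hq)

/-- Partial multivalued functions from `X` to `Y`: `f x` is the set of values at `x`, and `x` is in
the domain of `f` if `f x` is non-empty. -/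
abbrev Problem (X Y : RepSpace) : Type := X.carrier → Set Y.carrier

/-- `F` is a realizer of `f`: every name `p` of a point `x` in the domain of `f` is mapped to a
name of some value of `f` at `x`. -/
def Realizes {X Y : RepSpace} (F : Cantor →. Cantor) (f : Problem X Y) : Prop :=
  ∀ (p : Cantor) (x : X.carrier), x ∈ X.rep p → (f x).Nonempty →
    ∃ q ∈ F p, ∃ y ∈ Y.rep q, y ∈ f x

/-- The partial function `K⟨id, G H⟩`, that is `p ↦ K⟨p, G (H p)⟩`. -/
def sandwich (K G H : Cantor →. Cantor) : Cantor →. Cantor :=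
  fun p => (H p).bind fun q => (G q).bind fun r => K (pair p r)

/-- Weihrauch reducibility. -/
def Reducible {X Y Z W : RepSpace} (f : Problem X Y) (g : Problem Z W) : Prop :=
  ∃ K H : Cantor →. Cantor, Type2Computable K ∧ Type2Computable H ∧
    ∀ G : Cantor →. Cantor, Realizes G g → Realizes (sandwich K G H) f

/-- Strict Weihrauch reducibility. -/
def StrictlyReducible {X Y Z W : RepSpace} (f : Problem X Y) (g : Problem Z W) : Prop :=
  Reducible f g ∧ ¬ Reducible g f

/-- The identity on `X` as a problem. -/
def idProblem (X : RepSpace) : Problem X X := fun x => {x}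

/-- The product `f × g` of problems, `(f × g)(x, y) = f(x) × g(y)`. -/
def Problem.prod {X Y Z W : RepSpace} (f : Problem X Y) (g : Problem Z W) :
    Problem (X.prod Z) (Y.prod W) :=
  fun xz => f xz.1 ×ˢ g xz.2

/-- `X × (X × (⋯ × ℕ^ℕ))` with `n` factors `X`. -/
noncomputable def RepSpace.pow (X : RepSpace) : ℕ → RepSpace
  | 0 => baireSpace
  | n + 1 => X.prod (X.pow n)

/-- The finite powers of a problem: `f⁰` is the identity on Baire space and
`f^{n+1} = f × f^n`. -/
noncomputable def Problem.pow {X Y : RepSpace} (f : Problem X Y) :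
    (n : ℕ) → Problem (X.pow n) (Y.pow n)
  | 0 => idProblem baireSpace
  | n + 1 => Problem.prod f (Problem.pow f n)

open Classical in
/-- Sorting a binary sequence: `0^n 1^ω` if `p` contains the bit `0` exactly `n` times, and `0^ω` if
`p` contains the bit `0` infinitely often. -/
noncomputable def sortSeq (p : Cantor) : Cantor :=
  if {k | p k = false}.Finite then fun i => decide ({k | p k = false}.ncard ≤ i)
  else fun _ => false

/-- The problem `Sort`, single-valued and total on Cantor space. -/
noncomputable def SortProblem : Problem cantorSpace cantorSpace := fun p => {sortSeq p}

end Weihrauch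

/-! One reduction ignores the extra factor. For the other direction only continuity of computable
functions is used.

`Sort` is continuous at sequences with infinitely many zeros. At a sequence with finitely many zeros
it is discontinuous, but only because new zeros can appear arbitrarily far out (`tendsto_sortSeq`).
So if `H`, `K` reduce `Sort^(n+1)` to `Sort^n`, inserting a far zero into an input component with
finitely many zeros must produce a late zero in some component of the query `H p` that had only
finitely many (`exists_perturbation`).

Repeating such insertions while freezing longer and longer prefixes gives, in the limit, an input
whose query has one more component with infinitely many zeros (`exists_le_card_infiniteZeros`).
Using input components `0, …, n - 1` makes all `n` query components infinite in this sense.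
Component `n` still allows one more insertion, which would require an `(n+1)`-st query component. -/

open Filter Topology

namespace Weihrauch

/-! ### Topology of Cantor space and continuity of computable functions -/

theorem Cantor.exists_take_of_mem_nhds {p : Cantor} {s : Set Cantor} (hs : s ∈ 𝓝 p) :
    ∃ L : ℕ, ∀ p' : Cantor, (∀ m < L, p' m = p m) → p' ∈ s := by
  rw [nhds_pi, Filter.mem_pi'] at hs
  obtain ⟨I, t, ht, hts⟩ := hs
  refine ⟨I.sup id + 1, fun p' hp' => hts fun i hi => ?_⟩
  rw [hp' i (Nat.lt_succ_of_le (Finset.le_sup (f := id) hi))]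
  exact mem_of_mem_nhds (ht i)

theorem Cantor.tendsto_iff {α : Type*} {l : Filter α} {f : α → Cantor} {q : Cantor} :
    Tendsto f l (𝓝 q) ↔ ∀ m, ∀ᶠ a in l, f a m = q m := by
  simp [tendsto_pi_nhds]

theorem Cantor.eventually_agree (p : Cantor) (L : ℕ) : ∀ᶠ p' in 𝓝 p, ∀ m < L, p' m = p m := by
  have h : ∀ᶠ p' in 𝓝 p, ∀ m ∈ Finset.range L, p' m = p m := by
    rw [Filter.eventually_all_finset]
    exact fun m _ => Cantor.tendsto_iff.1 tendsto_id m
  simpa using h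

theorem Cantor.take_eq_take {p p' : Cantor} {n : ℕ} (h : ∀ m < n, p' m = p m) :
    p'.take n = p.take n :=
  List.map_congr_left fun m hm => h m (List.mem_range.1 hm)

theorem continuous_unpairL : Continuous unpairL :=
  continuous_pi fun n => continuous_apply (2 * n)

theorem continuous_unpairR : Continuous unpairR :=
  continuous_pi fun n => continuous_apply (2 * n + 1)

theorem continuous_pair : Continuous fun x : Cantor × Cantor => pair x.1 x.2 := by
  refine continuous_pi fun n => ?_
  unfold pair
  by_cases h : n % 2 = 0
  · simp only [h, if_true]
    exact (continuous_apply (n / 2)).comp continuous_fst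
  · simp only [h, if_false]
    exact (continuous_apply (n / 2)).comp continuous_snd

theorem tendsto_pair {α : Type*} {l : Filter α} {f g : α → Cantor} {p q : Cantor}
    (hf : Tendsto f l (𝓝 p)) (hg : Tendsto g l (𝓝 q)) :
    Tendsto (fun a => pair (f a) (g a)) l (𝓝 (pair p q)) :=
  (continuous_pair.tendsto (p, q)).comp (hf.prodMk_nhds hg)

open Classical in
/-- A total extension of a partial function on Cantor space. -/
noncomputable def totalize (F : Cantor →. Cantor) (p : Cantor) : Cantor :=
  if h : (F p).Dom then (F p).get h else p

theorem totalize_mem {F : Cantor →. Cantor} {p : Cantor} (h : (F p).Dom) : totalize F p ∈ F p := by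
  rw [totalize, dif_pos h]
  exact Part.get_mem h

theorem totalize_eq {F : Cantor →. Cantor} {p q : Cantor} (h : q ∈ F p) : totalize F p = q :=
  Part.mem_unique (totalize_mem (Part.dom_iff_mem.2 ⟨q, h⟩)) h

/-- Inputs sharing a prefix share the output word already written on it, and that word is eventually
as long as desired. -/
theorem Type2Computable.continuousOn {F : Cantor →. Cantor} (hF : Type2Computable F) :
    ContinuousOn (totalize F) {p | (F p).Dom} := by
  obtain ⟨φ, -, -, hφ⟩ := hF
  intro p hp
  refine Cantor.tendsto_iff.2 fun m => ?_
  obtain ⟨n, hn⟩ := (hφ p _ (totalize_mem hp)).2 (m + 1)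
  filter_upwards [self_mem_nhdsWithin, mem_nhdsWithin_of_mem_nhds (Cantor.eventually_agree p n)]
    with p' hp' hagree
  have h1 := (hφ p _ (totalize_mem hp)).1 n
  have h2 := (hφ p' _ (totalize_mem hp')).1 n
  rw [Cantor.take_eq_take hagree] at h2
  exact (List.map_inj_left.1 (h1.symm.trans h2) m (List.mem_range.2 hn)).symm

/-! ### Coordinates in names of tuples -/

/-- The `i`-th component of a name of an element of a power of Cantor space. -/
def component (i : ℕ) (q : Cantor) : Cantor := unpairL (unpairR^[i] q)

theorem continuous_component (i : ℕ) : Continuous (component i) :=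
  continuous_unpairL.comp (continuous_unpairR.iterate i)

theorem iterate_unpairR_apply (i : ℕ) (q : Cantor) (k : ℕ) :
    unpairR^[i] q k = q (2 ^ i * (k + 1) - 1) := by
  induction i generalizing q with
  | zero => simp
  | succ i ih =>
    rw [Function.iterate_succ_apply, ih, unpairR]
    congr 1
    have : 0 < 2 ^ i * (k + 1) := by positivity
    rw [pow_succ, mul_right_comm]
    omega

/-- The position in a name of the `k`-th bit of its `i`-th component. -/
def position (i k : ℕ) : ℕ := 2 ^ i * (2 * k + 1) - 1

theorem component_apply (i : ℕ) (q : Cantor) (k : ℕ) : component i q k = q (position i k) := by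
  rw [component, unpairL, iterate_unpairR_apply, position]

theorem position_succ (i k : ℕ) : position i k + 1 = 2 ^ i * (2 * k + 1) :=
  Nat.sub_add_cancel (Nat.mul_pos (by positivity) (by omega))

theorem le_position (i k : ℕ) : k ≤ position i k := by
  have h := position_succ i k
  have : 1 * (2 * k + 1) ≤ 2 ^ i * (2 * k + 1) := Nat.mul_le_mul_right _ Nat.one_le_two_pow
  omega

theorem position_injective (i : ℕ) : Function.Injective (position i) := by
  intro k l h
  have h' := position_succ i k
  rw [h, position_succ i l] at h'
  have := Nat.eq_of_mul_eq_mul_left (by positivity) h'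
  omega

theorem dvd_position_succ (i k : ℕ) : 2 ^ i ∣ position i k + 1 :=
  ⟨_, position_succ i k⟩

theorem not_dvd_position_succ (i k : ℕ) : ¬ 2 ^ (i + 1) ∣ position i k + 1 := by
  rw [position_succ, pow_succ, Nat.mul_dvd_mul_iff_left (by positivity)]
  omega

/-! ### Realizers of the powers of sorting -/

/-- The canonical realizer of the `n`-th power of the sorting problem. -/
noncomputable def sortPow : ℕ → Cantor → Cantor
  | 0, q => q
  | n + 1, q => pair (sortSeq (unpairL q)) (sortPow n (unpairR q))

theorem realizes_sortPow (n : ℕ) :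
    Realizes (fun q => Part.some (sortPow n q)) (SortProblem.pow n) := by
  intro p x hx hne
  refine ⟨sortPow n p, Part.mem_some _, ?_⟩
  clear hne
  induction n generalizing p with
  | zero => exact ⟨x, hx, rfl⟩
  | succ n ih =>
    obtain ⟨a, ha, hx⟩ := Part.mem_bind_iff.1 hx
    obtain ⟨b, hb, rfl⟩ := (Part.mem_map_iff _).1 hx
    obtain ⟨c, hc, hcb⟩ := ih (unpairR p) b hb
    obtain rfl := Part.mem_some_iff.1 ha
    refine ⟨(sortSeq (unpairL p), c), ?_, rfl, hcb⟩
    refine Part.mem_bind_iff.2 ⟨sortSeq (unpairL p), ?_, (Part.mem_map_iff _).2 ⟨c, ?_, rfl⟩⟩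
    · rw [sortPow, unpairL_pair]; exact Part.mem_some _
    · rwa [sortPow, unpairR_pair]

theorem component_eq_of_mem_pow {n : ℕ} {p q : Cantor} {x y : (cantorSpace.pow n).carrier}
    (hx : x ∈ (cantorSpace.pow n).rep p) (hy : y ∈ (cantorSpace.pow n).rep q)
    (hxy : y ∈ SortProblem.pow n x) {i : ℕ} (hi : i < n) :
    component i q = sortSeq (component i p) := by
  induction n generalizing p q i with
  | zero => omega
  | succ n ih =>
    obtain ⟨a, ha, hx⟩ := Part.mem_bind_iff.1 hx
    obtain ⟨b, hb, rfl⟩ := (Part.mem_map_iff _).1 hx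
    obtain ⟨c, hc, hy⟩ := Part.mem_bind_iff.1 hy
    obtain ⟨d, hd, rfl⟩ := (Part.mem_map_iff _).1 hy
    obtain rfl := Part.mem_some_iff.1 ha
    obtain rfl := Part.mem_some_iff.1 hc
    cases i with
    | zero => exact hxy.1
    | succ i => exact ih hb hd hxy.2 (by omega)

/-- Only the final Baire space factor restricts which sequences are names. -/
theorem exists_mem_pow_rep {n : ℕ} {p : Cantor} (hp : {k | unpairR^[n] p k = true}.Infinite) :
    ∃ x : (cantorSpace.pow n).carrier, x ∈ (cantorSpace.pow n).rep p := by
  induction n generalizing p with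
  | zero => exact ⟨blockLengths p, hp, rfl⟩
  | succ n ih =>
    obtain ⟨x, hx⟩ := ih (p := unpairR p) hp
    exact ⟨(unpairL p, x), Part.mem_bind_iff.2 ⟨_, Part.mem_some _, (Part.mem_map_iff _).2
      ⟨x, hx, rfl⟩⟩⟩

theorem sortPow_nonempty (n : ℕ) (x : (cantorSpace.pow n).carrier) :
    (SortProblem.pow n x).Nonempty := by
  induction n with
  | zero => exact ⟨x, rfl⟩
  | succ n ih =>
    obtain ⟨y, hy⟩ := ih x.2
    exact ⟨(sortSeq x.1, y), rfl, hy⟩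

/-! ### Continuity of sorting when late zeros are excluded -/

theorem sortSeq_ncard {p : Cantor} (hp : {k | p k = false}.Finite) :
    sortSeq p {k | p k = false}.ncard = true := by
  simp [sortSeq, hp]

theorem sortSeq_eq_false {p : Cantor} {m : ℕ}
    (h : {k | p k = false}.Finite → m < {k | p k = false}.ncard) : sortSeq p m = false := by
  unfold sortSeq
  split_ifs with hp
  · simpa using h hp
  · rfl

theorem tendsto_sortSeq (r : Cantor) (N : ℕ) :
    Tendsto sortSeq (𝓝[{r' | {k | r k = false}.Finite → ∀ k ≥ N, r' k = true}] r)
      (𝓝 (sortSeq r)) := by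
  rw [Cantor.tendsto_iff]
  intro m
  by_cases hr : {k | r k = false}.Finite
  -- With finitely many zeros in `r`, every admissible `r'` close enough to `r` equals `r`.
  · obtain ⟨B, hB⟩ := hr.bddAbove
    filter_upwards [self_mem_nhdsWithin,
      mem_nhdsWithin_of_mem_nhds (Cantor.eventually_agree r (max N (B + 1)))] with r' h1 h2
    suffices r' = r by rw [this]
    funext k
    by_cases hk : k < max N (B + 1)
    · exact h2 k hk
    · rw [h1 hr k (by omega)]
      by_contra hne
      have : k ≤ B := hB (by simpa using Ne.symm hne)
      omega
  -- Here `sortSeq r` is constantly `0`, and sharing `m + 1` zeros with `r` forces bit `m` of the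
  -- sorted sequence to be `0`.
  · obtain ⟨t, ht, htc⟩ := Set.Infinite.exists_subset_card_eq hr (m + 1)
    have hev : ∀ᶠ r' in 𝓝 r, ∀ k ∈ t, r' k = r k := by
      rw [Filter.eventually_all_finset]
      exact fun k _ => Cantor.tendsto_iff.1 tendsto_id k
    filter_upwards [mem_nhdsWithin_of_mem_nhds hev] with r' h'
    rw [sortSeq_eq_false (p := r) fun h => absurd h hr]
    refine sortSeq_eq_false fun hfin => ?_
    have hsub : (t : Set ℕ) ⊆ {k | r' k = false} := fun k hk => (h' k hk).trans (ht hk)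
    have := Set.ncard_le_ncard hsub hfin
    rw [Set.ncard_coe_finset] at this
    omega

theorem tendsto_sortPow (n : ℕ) (q : Cantor) (N : ℕ) :
    Tendsto (sortPow n) (𝓝[{q' | ∀ i < n, {k | component i q k = false}.Finite →
      ∀ k ≥ N, component i q' k = true}] q) (𝓝 (sortPow n q)) := by
  induction n generalizing q with
  | zero => exact tendsto_id.mono_left nhdsWithin_le_nhds
  | succ n ih =>
    refine tendsto_pair ?_ ?_
    · refine (tendsto_sortSeq (unpairL q) N).comp (tendsto_nhdsWithin_iff.2
        ⟨continuous_unpairL.continuousWithinAt, ?_⟩)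
      filter_upwards [self_mem_nhdsWithin] with q' hq' using hq' 0 (by omega)
    · refine (ih (unpairR q)).comp (tendsto_nhdsWithin_iff.2
        ⟨continuous_unpairR.continuousWithinAt, ?_⟩)
      filter_upwards [self_mem_nhdsWithin] with q' hq' i hi using hq' (i + 1) (by omega)

/-! ### The reduction to the next power -/

theorem type2Computable_comp {f len : ℕ → ℕ} (hf : Primrec f) (hlen : Primrec len)
    (hmono : Monotone len) (hunb : ∀ m, ∃ n, m ≤ len n) (hlt : ∀ n i, i < len n → f i < n) :
    Type2Computable (fun p : Cantor => Part.some fun i => p (f i)) := by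
  -- The default `false` is never used: `hlt` guarantees that the bits consulted have been read.
  refine ⟨fun w => (List.range (len w.length)).map fun i => w.getD (f i) false, ?_, ?_, ?_⟩
  · refine Primrec.to_comp (Primrec.list_map (Primrec.list_range.comp
      (hlen.comp Primrec.list_length)) ?_)
    exact (Primrec.list_getD false).comp Primrec.fst (hf.comp Primrec.snd)
  · rintro u _ ⟨t, rfl⟩
    obtain ⟨d, hd⟩ := Nat.exists_eq_add_of_le (hmono (show u.length ≤ (u ++ t).length by simp))
    simp only [hd, List.range_add, List.map_append]
    refine ⟨_, congrArg (· ++ _) (List.map_congr_left fun i hi => ?_)⟩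
    rw [List.getD_append _ _ _ _ (hlt _ _ (List.mem_range.1 hi))]
  · intro p q hq
    obtain rfl := Part.mem_some_iff.1 hq
    constructor
    · intro n
      simp only [Cantor.take, List.length_map, List.length_range]
      refine List.map_congr_left fun i hi => ?_
      have := hlt n i (List.mem_range.1 hi)
      simp [List.getD, this]
    · simpa [Cantor.take] using hunb

theorem sort_pow_reducible_succ (n : ℕ) :
    Reducible (SortProblem.pow n) (SortProblem.pow (n + 1)) := by
  -- The query is `⟨p, p⟩`; in `⟨p, ⟨a, b⟩⟩` bit `i` of `b` sits at `2 * (2 * i + 1) + 1`.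
  refine ⟨fun s => Part.some fun i => s (4 * i + 3), fun p => Part.some fun i => p (i / 2),
    type2Computable_comp (len := fun n => n / 4) ?_ ?_ ?_ ?_ ?_,
    type2Computable_comp (len := fun n => 2 * n) ?_ ?_ ?_ ?_ ?_, ?_⟩
  · exact Primrec.nat_add.comp (Primrec.nat_mul.comp (Primrec.const 4) Primrec.id) (Primrec.const 3)
  · exact Primrec.nat_div.comp Primrec.id (Primrec.const 4)
  · exact fun a b h => Nat.div_le_div_right h
  · exact fun m => ⟨4 * m, by omega⟩
  · intro n i hi; omega
  · exact Primrec.nat_div.comp Primrec.id (Primrec.const 2)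
  · exact Primrec.nat_mul.comp (Primrec.const 2) Primrec.id
  · exact fun a b h => Nat.mul_le_mul_left 2 h
  · exact fun m => ⟨m, by omega⟩
  · intro n i hi; omega
  · intro G hG p x hx hne
    have hL : unpairL (fun i => p (i / 2)) = p := by funext k; simp [unpairL]
    have hR : unpairR (fun i => p (i / 2)) = p := by
      funext k
      simp only [unpairR]
      congr 1
      omega
    obtain ⟨z, hz⟩ := hne
    obtain ⟨q, hq, y, hy, hxy⟩ := hG (fun i => p (i / 2)) (p, x)
      (Part.mem_bind_iff.2 ⟨p, by rw [hL]; exact Part.mem_some _,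
        (Part.mem_map_iff _).2 ⟨x, by rwa [hR], rfl⟩⟩) ⟨(sortSeq p, z), rfl, hz⟩
    obtain ⟨c, hc, hy⟩ := Part.mem_bind_iff.1 hy
    obtain ⟨d, hd, rfl⟩ := (Part.mem_map_iff _).1 hy
    refine ⟨unpairR q, ?_, d, hd, hxy.2⟩
    refine Part.mem_bind_iff.2 ⟨_, Part.mem_some _, Part.mem_bind_iff.2 ⟨q, hq, ?_⟩⟩
    rw [Part.mem_some_iff]
    funext i
    have h1 : (4 * i + 3) % 2 = 1 := by omega
    have h2 : (4 * i + 3) / 2 = 2 * i + 1 := by omega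
    simp [unpairR, pair, h1, h2]

/-! ### Counting components with late or infinitely many zeros -/

open Classical in
/-- The components below `n` that have a zero at or after position `N`. -/
noncomputable def lateZeros (n N : ℕ) (q : Cantor) : Finset ℕ :=
  {i ∈ Finset.range n | ∃ k ≥ N, component i q k = false}

open Classical in
/-- The components below `n` that have infinitely many zeros. -/
noncomputable def infiniteZeros (n : ℕ) (q : Cantor) : Finset ℕ :=
  {i ∈ Finset.range n | {k | component i q k = false}.Infinite}

theorem mem_lateZeros {n N i : ℕ} {q : Cantor} :
    i ∈ lateZeros n N q ↔ i < n ∧ ∃ k ≥ N, component i q k = false := by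
  simp [lateZeros]

theorem mem_infiniteZeros {n i : ℕ} {q : Cantor} :
    i ∈ infiniteZeros n q ↔ i < n ∧ {k | component i q k = false}.Infinite := by
  simp [infiniteZeros]

theorem infiniteZeros_subset_lateZeros (n N : ℕ) (q : Cantor) :
    infiniteZeros n q ⊆ lateZeros n N q := by
  intro i hi
  obtain ⟨hin, hi⟩ := mem_infiniteZeros.1 hi
  obtain ⟨k, hk, hNk⟩ := hi.exists_gt N
  exact mem_lateZeros.2 ⟨hin, k, hNk.le, hk⟩

theorem card_lateZeros_le (n N : ℕ) (q : Cantor) : (lateZeros n N q).card ≤ n := by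
  classical exact (Finset.card_filter_le _ _).trans (Finset.card_range n).le

theorem lateZeros_anti (n : ℕ) (q : Cantor) {N M : ℕ} (h : N ≤ M) :
    lateZeros n M q ⊆ lateZeros n N q := fun i hi => by
  obtain ⟨hin, k, hk, hq⟩ := mem_lateZeros.1 hi
  exact mem_lateZeros.2 ⟨hin, k, h.trans hk, hq⟩

theorem exists_lateZeros_eq_infiniteZeros (n : ℕ) (q : Cantor) :
    ∃ N, lateZeros n N q = infiniteZeros n q := by
  have h : ∀ᶠ N in atTop, ∀ i ∈ Finset.range n, i ∈ lateZeros n N q → i ∈ infiniteZeros n q := by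
    rw [Filter.eventually_all_finset]
    intro i hi
    by_cases hfin : {k | component i q k = false}.Finite
    · obtain ⟨B, hB⟩ := hfin.bddAbove
      filter_upwards [eventually_gt_atTop B] with N hN hmem
      obtain ⟨-, k, hk, hq⟩ := mem_lateZeros.1 hmem
      have : k ≤ B := hB hq
      omega
    · exact Eventually.of_forall fun N _ => mem_infiniteZeros.2 ⟨Finset.mem_range.1 hi, hfin⟩
  obtain ⟨N, hN⟩ := h.exists
  refine ⟨N, Finset.Subset.antisymm (fun i hi => ?_) (infiniteZeros_subset_lateZeros n N q)⟩
  exact hN i (Finset.mem_range.2 (mem_lateZeros.1 hi).1) hi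

/-- Each membership is witnessed by a single bit, so it survives small changes of `q`. -/
theorem eventually_lateZeros_subset (n N : ℕ) (q : Cantor) :
    ∀ᶠ q' in 𝓝 q, lateZeros n N q ⊆ lateZeros n N q' := by
  have h : ∀ᶠ q' in 𝓝 q, ∀ i ∈ lateZeros n N q, i ∈ lateZeros n N q' := by
    rw [Filter.eventually_all_finset]
    intro i hi
    obtain ⟨hin, k, hk, hq⟩ := mem_lateZeros.1 hi
    filter_upwards [Cantor.tendsto_iff.1 ((continuous_component i).tendsto q) k] with q' hq'
    exact mem_lateZeros.2 ⟨hin, k, hk, hq'.trans hq⟩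
  exact h

theorem tendsto_update_position (p : Cantor) (j : ℕ) (b : Bool) :
    Tendsto (fun k => Function.update p (position j k) b) atTop (𝓝 p) := by
  refine Cantor.tendsto_iff.2 fun m => ?_
  filter_upwards [eventually_gt_atTop m] with k hk
  exact Function.update_of_ne (by have := le_position j k; omega) _ _

theorem component_update_position (p : Cantor) (j k : ℕ) (b : Bool) :
    component j (Function.update p (position j k) b) = Function.update (component j p) k b := by
  funext l
  by_cases hl : l = k
  · subst hl; simp [component_apply]
  · rw [Function.update_of_ne hl, component_apply, component_apply,
      Function.update_of_ne ((position_injective j).ne hl)]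

theorem sortSeq_update_ncard {r : Cantor} (hr : {k | r k = false}.Finite) {k : ℕ}
    (hk : r k = true) :
    sortSeq (Function.update r k false) {k | r k = false}.ncard = false := by
  refine sortSeq_eq_false fun _ => ?_
  have h : {l | Function.update r k false l = false} = insert k {l | r l = false} := by
    ext l
    by_cases hl : l = k <;> simp [hl]
  rw [h, Set.ncard_insert_of_notMem (by simp [hk]) hr]
  omega

/-! ### Diagonalization against a continuous query map -/

section Diagonalization

variable {n : ℕ} {h : Cantor → Cantor} {D : Set Cantor}

/-- Positions `m` with `2 ^ j ∣ m + 1` carry the components from `j` on and the Baire tail. A far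
zero in component `j` changes a bit of its sorted sequence, so by `key` a query component with
finitely many zeros gains a zero beyond `N`. Components with infinitely many zeros keep a late one
by continuity, and `L` makes all this stable. -/
theorem exists_perturbation (hh : ContinuousOn h D)
    (hD : ∀ p N, (∀ m ≥ N, 2 ^ (n + 1) ∣ m + 1 → p m = true) → p ∈ D)
    (key : ∀ p ∈ D, ∀ j ≤ n, ∀ N c, ∀ᶠ p' in 𝓝[D] p,
      (∀ i < n, {k | component i (h p) k = false}.Finite →
        ∀ k ≥ N, component i (h p') k = true) →
      sortSeq (component j p') c = sortSeq (component j p) c)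
    {j : ℕ} (hj : j ≤ n) {p : Cantor} {N : ℕ} (hp : ∀ m ≥ N, 2 ^ j ∣ m + 1 → p m = true) :
    ∃ (p' : Cantor) (L : ℕ), N < L ∧ (∀ m < N, p' m = p m) ∧
      (∀ m ≥ N, 2 ^ (j + 1) ∣ m + 1 → p' m = true) ∧
      ∀ p'' ∈ D, (∀ m < L, p'' m = p' m) →
        (infiniteZeros n (h p)).card < (lateZeros n N (h p'')).card := by
  have hp' : ∀ k ≥ N, ∀ m ≥ N, 2 ^ (j + 1) ∣ m + 1 →
      Function.update p (position j k) false m = true := by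
    intro k hk m hm hdvd
    rw [Function.update_of_ne]
    · exact hp m hm ((pow_dvd_pow 2 (by omega)).trans hdvd)
    · rintro rfl
      exact not_dvd_position_succ j k hdvd
  have hpD' : ∀ k ≥ N, Function.update p (position j k) false ∈ D := fun k hk =>
    hD _ N fun m hm hdvd => hp' k hk m hm ((pow_dvd_pow 2 (by omega)).trans hdvd)
  have hpD : p ∈ D := hD p N fun m hm hdvd => hp m hm ((pow_dvd_pow 2 (by omega)).trans hdvd)
  have hone : ∀ k ≥ N, component j p k = true := fun k hk => by
    rw [component_apply]
    exact hp _ (hk.trans (le_position j k)) (dvd_position_succ j k)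
  have hfin : {k | component j p k = false}.Finite :=
    (Set.finite_lt_nat N).subset fun k hk => by
      by_contra hlt
      have := hone k (not_lt.1 hlt)
      simp_all
  have htend : Tendsto (fun k => Function.update p (position j k) false) atTop (𝓝[D] p) :=
    tendsto_nhdsWithin_iff.2 ⟨tendsto_update_position p j false,
      (eventually_ge_atTop N).mono hpD'⟩
  obtain ⟨k, hkN, hkey, hsub⟩ := ((eventually_ge_atTop N).and
    ((htend.eventually (key p hpD j hj N {k | component j p k = false}.ncard)).and
      (htend.eventually ((hh p hpD).eventually (eventually_lateZeros_subset n N (h p)))))).exists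
  -- Otherwise `key` would preserve the bit indexed by the number of zeros, which the insertion
  -- turns from `1` to `0`.
  obtain ⟨i, hin, hifin, k', hk', hik'⟩ : ∃ i < n, {k | component i (h p) k = false}.Finite ∧
      ∃ k' ≥ N, component i (h (Function.update p (position j k) false)) k' = false := by
    by_contra! hcon
    have := hkey fun i hi hf k' hk' => by simpa using hcon i hi hf k' hk'
    rw [component_update_position, sortSeq_ncard hfin, sortSeq_update_ncard hfin (hone k hkN)]
      at this
    simp at this
  obtain ⟨L, hL⟩ := Cantor.exists_take_of_mem_nhds (mem_nhdsWithin_iff_eventually.1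
    ((hh _ (hpD' k hkN)).eventually (eventually_lateZeros_subset n N _)))
  refine ⟨Function.update p (position j k) false, max L (N + 1), by omega, fun m hm => ?_,
    hp' k hkN, fun p'' hp'' hagree => Finset.card_lt_card ?_⟩
  · exact Function.update_of_ne (by have := le_position j k; omega) _ _
  · have hsub' := hL p'' (fun m hm => hagree m (by omega)) hp''
    refine (Finset.ssubset_iff_of_subset
      ((infiniteZeros_subset_lateZeros n N _).trans (hsub.trans hsub'))).2 ⟨i, ?_, fun hi => ?_⟩
    · exact hsub' (mem_lateZeros.2 ⟨hin, k', hk', hik'⟩)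
    · exact (mem_infiniteZeros.1 hi).2 hifin

theorem exists_le_card_infiniteZeros (hh : ContinuousOn h D)
    (hD : ∀ p N, (∀ m ≥ N, 2 ^ (n + 1) ∣ m + 1 → p m = true) → p ∈ D)
    (key : ∀ p ∈ D, ∀ j ≤ n, ∀ N c, ∀ᶠ p' in 𝓝[D] p,
      (∀ i < n, {k | component i (h p) k = false}.Finite →
        ∀ k ≥ N, component i (h p') k = true) →
      sortSeq (component j p') c = sortSeq (component j p) c)
    {j : ℕ} (hj : j ≤ n) (p : Cantor) (N : ℕ) :
    ∃ p' : Cantor, (∀ m < N, p' m = p m) ∧ (∀ m ≥ N, 2 ^ j ∣ m + 1 → p' m = true) ∧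
      j ≤ (infiniteZeros n (h p')).card := by
  induction j generalizing p N with
  | zero =>
    refine ⟨fun m => if m < N then p m else true, fun m hm => if_pos hm, fun m hm _ => ?_,
      Nat.zero_le _⟩
    exact if_neg (by omega)
  | succ j ih =>
    -- A state is a sequence with the length of its frozen prefix. That length is also the threshold
    -- for late zeros, so the thresholds tend to infinity.
    have step : ∀ s : Cantor × ℕ, ∃ s' : Cantor × ℕ, s.2 < s'.2 ∧ (∀ m < s.2, s'.1 m = s.1 m) ∧
        (∀ m ≥ s.2, 2 ^ (j + 1) ∣ m + 1 → s'.1 m = true) ∧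
        ∀ p'' ∈ D, (∀ m < s'.2, p'' m = s'.1 m) → j + 1 ≤ (lateZeros n s.2 (h p'')).card := by
      rintro ⟨p, N⟩
      obtain ⟨p₁, h1, h2, h3⟩ := ih (by omega) p N
      obtain ⟨p₂, L, hL, h4, h5, h6⟩ := exists_perturbation hh hD key (by omega) h2
      exact ⟨(p₂, L), hL, fun m hm => (h4 m hm).trans (h1 m hm), h5,
        fun p'' hp'' hagree => (Nat.succ_le_succ h3).trans (h6 p'' hp'' hagree)⟩
    choose next hlt hagree hones hcard using step
    let s : ℕ → Cantor × ℕ := fun t => next^[t] (p, N)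
    have hs : ∀ t, s (t + 1) = next (s t) := fun t => Function.iterate_succ_apply' _ _ _
    have hmono : StrictMono fun t => (s t).2 := strictMono_nat_of_lt_succ fun t => by
      rw [hs]; exact hlt _
    have hstab : ∀ t d, ∀ m < (s t).2, (s (t + d)).1 m = (s t).1 m := by
      intro t d m hm
      induction d with
      | zero => rfl
      | succ d ihd =>
        rw [← add_assoc, hs, hagree _ m (hm.trans_le (hmono.monotone (Nat.le_add_right t d))), ihd]
    -- Frozen lengths strictly increase, so bit `m` is final by stage `m + 1`.
    let q : Cantor := fun m => (s (m + 1)).1 m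
    have hq : ∀ t, ∀ m < (s t).2, q m = (s t).1 m := by
      intro t m hm
      have hm' : m < (s (m + 1)).2 := (Nat.lt_succ_self m).trans_le (hmono.id_le (m + 1))
      rcases le_total t (m + 1) with hle | hle
      · obtain ⟨d, hd⟩ := Nat.exists_eq_add_of_le hle
        change (s (m + 1)).1 m = _
        rw [hd, hstab t d m hm]
      · obtain ⟨d, rfl⟩ := Nat.exists_eq_add_of_le hle
        exact (hstab (m + 1) d m hm').symm
    have hqones : ∀ m ≥ N, 2 ^ (j + 1) ∣ m + 1 → q m = true := by
      intro m hm hdvd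
      have h1 : ∀ t, m < (s t).2 → (s t).1 m = true := by
        intro t
        induction t with
        | zero => exact fun hlt => absurd hlt (not_lt.2 hm)
        | succ t iht =>
          intro _
          rw [hs]
          rcases lt_or_ge m (s t).2 with hlt | hge
          · rw [hagree _ m hlt, iht hlt]
          · exact hones _ m hge hdvd
      exact h1 (m + 1) ((Nat.lt_succ_self m).trans_le (hmono.id_le (m + 1)))
    have hqD : q ∈ D := hD q N fun m hm hdvd =>
      hqones m hm ((pow_dvd_pow 2 (by omega)).trans hdvd)
    refine ⟨q, hq 0, hqones, ?_⟩
    -- Beyond `M` late zeros occur only in components with infinitely many; the threshold at stage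
    -- `M` is at least `M`.
    obtain ⟨M, hM⟩ := exists_lateZeros_eq_infiniteZeros n (h q)
    rw [← hM]
    refine (hcard (s M) q hqD ?_).trans
      (Finset.card_le_card (lateZeros_anti n (h q) (hmono.id_le M)))
    rw [← hs]
    exact hq (M + 1)

end Diagonalization

/-! ### Impossibility of the converse reduction -/

theorem not_sort_pow_succ_reducible (n : ℕ) :
    ¬ Reducible (SortProblem.pow (n + 1)) (SortProblem.pow n) := by
  rintro ⟨K, H, hK, hH, hred⟩
  let D : Set Cantor := {p | {k | unpairR^[n + 1] p k = true}.Infinite}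
  have hD : ∀ p N, (∀ m ≥ N, 2 ^ (n + 1) ∣ m + 1 → p m = true) → p ∈ D := by
    intro p N hp
    refine (Set.Ici_infinite N).mono fun k hk => ?_
    change unpairR^[n + 1] p k = true
    rw [iterate_unpairR_apply]
    have h1 : 1 * (k + 1) ≤ 2 ^ (n + 1) * (k + 1) := Nat.mul_le_mul_right _ Nat.one_le_two_pow
    have hk : N ≤ k := hk
    refine hp _ (by omega) ?_
    rw [Nat.sub_add_cancel (by omega)]
    exact dvd_mul_right _ _
  have main : ∀ p ∈ D, (H p).Dom ∧ (K (pair p (sortPow n (totalize H p)))).Dom ∧ ∀ j ≤ n,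
      component j (totalize K (pair p (sortPow n (totalize H p)))) =
        sortSeq (component j p) := by
    intro p hp
    obtain ⟨x, hx⟩ := exists_mem_pow_rep hp
    obtain ⟨q, hq, y, hy, hxy⟩ := hred _ (realizes_sortPow n) p x hx (sortPow_nonempty _ x)
    obtain ⟨a, ha, hq⟩ := Part.mem_bind_iff.1 hq
    obtain ⟨b, hb, hq⟩ := Part.mem_bind_iff.1 hq
    obtain rfl := Part.mem_some_iff.1 hb
    obtain rfl := totalize_eq ha
    refine ⟨Part.dom_iff_mem.2 ⟨_, ha⟩, Part.dom_iff_mem.2 ⟨_, hq⟩, fun j hj => ?_⟩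
    rw [totalize_eq hq]
    exact component_eq_of_mem_pow hx hy hxy (by omega)
  have hh : ContinuousOn (totalize H) D := hH.continuousOn.mono fun p hp => (main p hp).1
  have key : ∀ p ∈ D, ∀ j ≤ n, ∀ N c, ∀ᶠ p' in 𝓝[D] p,
      (∀ i < n, {k | component i (totalize H p) k = false}.Finite →
        ∀ k ≥ N, component i (totalize H p') k = true) →
      sortSeq (component j p') c = sortSeq (component j p) c := by
    -- On `B` the sorted query varies continuously at `p`, hence so does the output of `K`.
    intro p hp j hj N c
    let B : Set Cantor := {p' | ∀ i < n, {k | component i (totalize H p) k = false}.Finite →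
        ∀ k ≥ N, component i (totalize H p') k = true}
    suffices hB : ∀ᶠ p' in 𝓝[D ∩ B] p, sortSeq (component j p') c = sortSeq (component j p) c by
      rw [eventually_nhdsWithin_iff] at hB ⊢
      filter_upwards [hB] with p' hp' hpD hpB using hp' ⟨hpD, hpB⟩
    have h1 : Tendsto (fun p' => sortPow n (totalize H p')) (𝓝[D ∩ B] p)
        (𝓝 (sortPow n (totalize H p))) := by
      refine (tendsto_sortPow n (totalize H p) N).comp (tendsto_nhdsWithin_iff.2
        ⟨(hh p hp).mono Set.inter_subset_left, ?_⟩)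
      filter_upwards [self_mem_nhdsWithin] with p' hp' using hp'.2
    have h2 : Tendsto (fun p' => totalize K (pair p' (sortPow n (totalize H p')))) (𝓝[D ∩ B] p)
        (𝓝 (totalize K (pair p (sortPow n (totalize H p))))) := by
      refine (hK.continuousOn _ (main p hp).2.1).tendsto.comp (tendsto_nhdsWithin_iff.2
        ⟨tendsto_pair (tendsto_id.mono_left nhdsWithin_le_nhds) h1, ?_⟩)
      filter_upwards [self_mem_nhdsWithin] with p' hp' using (main p' hp'.1).2.1
    filter_upwards [Cantor.tendsto_iff.1 (((continuous_component j).tendsto _).comp h2) c,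
      self_mem_nhdsWithin] with p' hp' hmem
    simpa [(main p hp).2.2 j hj, (main p' hmem.1).2.2 j hj] using hp'
  obtain ⟨p, -, hp, hcard⟩ := exists_le_card_infiniteZeros hh hD key le_rfl (fun _ => true) 0
  obtain ⟨p', L, -, -, hp', hlt⟩ := exists_perturbation hh hD key le_rfl hp
  have := hlt p' (hD p' 0 hp') fun _ _ => rfl
  have := card_lateZeros_le n 0 (totalize H p')
  omega

end Weihrauch

theorem mainTheorem10 (n : ℕ) :
    Weihrauch.StrictlyReducible
      (Weihrauch.Problem.pow Weihrauch.SortProblem n) (Weihrauch.Problem.pow Weihrauch.SortProblem (n + 1)) :=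
  ⟨Weihrauch.sort_pow_reducible_succ n, Weihrauch.not_sort_pow_succ_reducible n⟩
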